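/- Let $T,J\in\mathbb N$, let $\Omega$ be a non-empty subset of $(\mathbb R_{++}\times\mathbb R^J)^T$ (where $\mathbb R_{++}=(0,\infty)$) with the Euclidean metric, and let $Z:\Omega\to[1,\infty)$ be a continuous function whose sublevel sets $\{\omega\in\Omega: Z(\omega)\le z\}$, $z\in\mathbb R_+$, are all compact. Let $B$ be the space of Borel measurable functions $X:\Omega\to\mathbb R$, and $B^+=\{X\in B: X\ge 0\}$. Let $B_Z$ be the set of all $X\in B$ such that $X/Z$ is bounded, and let $U_Z$ and $C_Z$ be the sets of upper semicontinuous and of continuous elements of $B_Z$, respectively. Let $\mathcal P_Z$ be the set of Borel probability measures $\mathbb P$ on $\Omega$ with $\mathbb E^{\mathbb P}Z<\infty$. Let $G\subseteq B$ with $0\in G$, and let $A\subseteq B$ be such that $B^+\subseteq A$, $A+B^+\subseteq A$ and $A-G$ is convex. Define $$\phi(X)=\inf\{m\in\mathbb R: m-X\in A-G\}\quad(\inf\emptyset=+\infty),\qquad \phi^*(\mathbb P)=\sup_{X\in C_Z}\bigl(\mathbb E^{\mathbb P}X-\phi(X)\bigr),\quad \mathbb P\in\mathcal P_Z .$$ Assume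 that $$\text{for every integer } n\ge 1 \text{ there exists } z\in\mathbb R_+ \text{ such that } n(Z-z)^+-\tfrac1n\in G-A. \tag{1}$$ Then the following three conditions are equivalent: (i) there exist no $X\in G-A$ and $\varepsilon>0$ such that $X\ge\varepsilon$; (ii) there exists $\mathbb P\in\mathcal P_Z$ such that $\mathbb E^{\mathbb P}X\le 0$ for all $X\in C_Z\cap(G-A)$; (iii) $\phi$ is real-valued on $B_Z$, $\phi(0)=0$, and $\phi(X)=\max_{\mathbb P\in\mathcal P_Z}\bigl(\mathbb E^{\mathbb P}X-\phi^*(\mathbb P)\bigr)$ for all $X\in C_Z$ (the maximum being attained). If, in addition to (1), $$\phi(X)=\inf_{Y\in C_Z,\,Y\ge X}\phi(Y)\quad\text{for all } X\in U_Z, \tag{2}$$ then (i)–(iii) are also equivalent to each of the following three conditions: (iv) there exists no $X\in G-A$ such that $X(\omega)>0$ for all $\omega\in\Omega$; (v) there exists $\mathbb P\in\mathcal P_Z$ such that $\mathbb E^{\mathbb P}X\le 0$ for all $X\in U_Z\cap(G-A)$; (vi) $\phi$ is real-valued on $B_Z$, $\phi(0)=0$, and $\phi(X)=\max_{\mathbb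 P\in\mathcal P_Z}\bigl(\mathbb E^{\mathbb P}X-\phi^*(\mathbb P)\bigr)$ for all $X\in U_Z$ (the maximum being attained). -/

import Mathlib

open MeasureTheory
open scoped Pointwise

noncomputable section

namespace RobustHedging

/-- The ambient path space `(ℝ × ℝ^J)^T` with the Euclidean metric. The coordinate `ω (t, j)` is the
price at time `t + 1` of asset `j`; asset `0` is the numeraire. -/
abbrev PathSpace (T J : ℕ) : Type := EuclideanSpace ℝ (Fin T × Fin (J + 1))

/-- The set `(ℝ₊₊ × ℝ^J)^T` of all paths along which the numeraire is strictly positive. -/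
def positivePaths (T J : ℕ) : Set (PathSpace T J) := {ω | ∀ t : Fin T, 0 < ω (t, 0)}

/-- The space `B` of all Borel measurable real functions. -/
def B (Ω : Type*) [MeasurableSpace Ω] : Set (Ω → ℝ) := {X | Measurable X}

/-- The cone `B⁺` of non-negative Borel measurable functions. -/
def BPlus (Ω : Type*) [MeasurableSpace Ω] : Set (Ω → ℝ) := {X | X ∈ B Ω ∧ ∀ ω, 0 ≤ X ω}

/-- `B_Z`: the measurable functions `X` such that `X / Z` is bounded. -/
def BZ {Ω : Type*} [MeasurableSpace Ω] (Z : Ω → ℝ) : Set (Ω → ℝ) :=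
  {X | X ∈ B Ω ∧ ∃ c : ℝ, ∀ ω, |X ω / Z ω| ≤ c}

/-- `U_Z`: the upper semicontinuous elements of `B_Z`. -/
def UZ {Ω : Type*} [TopologicalSpace Ω] [MeasurableSpace Ω] (Z : Ω → ℝ) : Set (Ω → ℝ) :=
  {X | X ∈ BZ Z ∧ UpperSemicontinuous X}

/-- `C_Z`: the continuous elements of `B_Z`. -/
def CZ {Ω : Type*} [TopologicalSpace Ω] [MeasurableSpace Ω] (Z : Ω → ℝ) : Set (Ω → ℝ) :=
  {X | X ∈ BZ Z ∧ Continuous X}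

/-- `𝒫_Z`: the Borel probability measures that integrate `Z`. -/
def PZ {Ω : Type*} [MeasurableSpace Ω] (Z : Ω → ℝ) : Set (Measure Ω) :=
  {P | IsProbabilityMeasure P ∧ Integrable Z P}

/-- The superhedging functional `φ(X) = inf {m ∈ ℝ : m - X ∈ A - G}`, with `inf ∅ = +∞`. -/
def phi {Ω : Type*} (G A : Set (Ω → ℝ)) (X : Ω → ℝ) : EReal :=
  sInf ((fun m : ℝ => (m : EReal)) '' {m : ℝ | (fun ω => m - X ω) ∈ A - G})

/-- The convex conjugate `φ*(P) = sup_{X ∈ C_Z} (E^P X - φ(X))`. Elements of `C_Z` are integrable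
under every `P ∈ 𝒫_Z`, and a real number minus an extended real is never of the form `∞ - ∞`. -/
def phiStar {Ω : Type*} [TopologicalSpace Ω] [MeasurableSpace Ω] (Z : Ω → ℝ) (G A : Set (Ω → ℝ))
    (P : Measure Ω) : EReal :=
  ⨆ X ∈ CZ Z, (((∫ ω, X ω ∂P : ℝ) : EReal) - phi G A X)

/-- For every `n ≥ 1` some `n (Z - z)⁺ - 1/n` with `z ≥ 0` belongs to `G - A`. -/
def CallCondition {Ω : Type*} (Z : Ω → ℝ) (G A : Set (Ω → ℝ)) : Prop :=
  ∀ n : ℕ, 0 < n → ∃ z : ℝ, 0 ≤ z ∧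
    (fun ω => (n : ℝ) * max (Z ω - z) 0 - 1 / (n : ℝ)) ∈ G - A

/-- `φ(X) = inf_{Y ∈ C_Z, Y ≥ X} φ(Y)` for all `X ∈ U_Z`. -/
def UscCondition {Ω : Type*} [TopologicalSpace Ω] [MeasurableSpace Ω] (Z : Ω → ℝ)
    (G A : Set (Ω → ℝ)) : Prop :=
  ∀ X ∈ UZ Z, phi G A X = sInf (phi G A '' {Y | Y ∈ CZ Z ∧ ∀ ω, X ω ≤ Y ω})

/-- No uniform arbitrage: no `X ∈ G - A` satisfies `X ≥ ε` for some `ε > 0`. -/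
def NoUniformArbitrage {Ω : Type*} (G A : Set (Ω → ℝ)) : Prop :=
  ¬ ∃ X ∈ G - A, ∃ ε : ℝ, 0 < ε ∧ ∀ ω, ε ≤ X ω

/-- No pointwise arbitrage: no `X ∈ G - A` is strictly positive everywhere. -/
def NoPointwiseArbitrage {Ω : Type*} (G A : Set (Ω → ℝ)) : Prop :=
  ¬ ∃ X ∈ G - A, ∀ ω, 0 < X ω

/-- Some `P ∈ 𝒫_Z` satisfies `E^P X ≤ 0` for all `X ∈ D ∩ (G - A)`. -/
def HasPricingMeasure {Ω : Type*} [MeasurableSpace Ω] (Z : Ω → ℝ) (G A D : Set (Ω → ℝ)) : Prop :=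
  ∃ P ∈ PZ Z, ∀ X ∈ D ∩ (G - A), ∫ ω, X ω ∂P ≤ 0

/-- `φ` is real-valued on `B_Z`, `φ(0) = 0`, and `φ(X) = max_{P ∈ 𝒫_Z} (E^P X - φ*(P))`, with the
maximum attained, for all `X ∈ D`. -/
def HasDualFormula {Ω : Type*} [TopologicalSpace Ω] [MeasurableSpace Ω] (Z : Ω → ℝ)
    (G A D : Set (Ω → ℝ)) : Prop :=
  (∀ X ∈ BZ Z, ∃ r : ℝ, phi G A X = (r : EReal)) ∧
  phi G A 0 = 0 ∧
  ∀ X ∈ D, IsGreatest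
    ((fun P : Measure Ω => ((∫ ω, X ω ∂P : ℝ) : EReal) - phiStar Z G A P) '' PZ Z) (phi G A X)

end RobustHedging

end

namespace RobustHedging

/-! Since `φ` is convex, monotone and translation invariant, a subgradient of `φ` on `B_Z` at `X` is
a positive linear functional that maps `1` to `1`. Condition (1) makes it small on the calls
`(Z - z)⁺` with large strike `z`, so its values on `C_Z` are limits of its values on compactly
supported functions. By the Riesz representation theorem it is on `C_Z` the integral against some
`P ∈ 𝒫_Z`, and this `P` attains the maximum in the dual formula. For upper semicontinuous `X`, the
products of `Z` and Lipschitz envelopes of `X / Z` approximate `X` from above in `C_Z`. -/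

open Filter Topology Set
open TopologicalSpace (PseudoMetrizableSpace MetrizableSpace)
open scoped CompactlySupported NNReal

theorem nonneg_of_mk_zero_mem_hull {E : Type*} [AddCommGroup E] [Module ℝ E] {S : Set (E × ℝ)}
    (hS : Convex ℝ S) (h : ∀ s, (0, s) ∈ S → 0 ≤ s) {r : ℝ}
    (hr : (0, r) ∈ ConvexCone.hull ℝ S) : 0 ≤ r := by
  obtain ⟨c, hc, ⟨y, s⟩, hys, heq⟩ := (ConvexCone.mem_hull_of_convex hS).1 hr
  obtain ⟨hy, rfl⟩ : c • y = 0 ∧ c * s = r := by simpa using heq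
  obtain rfl : y = 0 := (smul_eq_zero.1 hy).resolve_left hc.ne'
  exact mul_nonneg hc.le (h s hys)

theorem exists_linearMap_le_sub_of_convexOn {E : Type*} [AddCommGroup E] [Module ℝ E] {f : E → ℝ}
    (hf : ConvexOn ℝ univ f) (x : E) : ∃ l : E →ₗ[ℝ] ℝ, ∀ y, l y ≤ f (x + y) - f x := by
  -- Extend `(0, r) ↦ r` to a functional that is nonnegative on the cone generated by the epigraph
  -- of `y ↦ f (x + y) - f x`; its restriction to `E × {0}` is minus a subgradient.
  let epi : Set (E × ℝ) := {p | f (x + p.1) ≤ f x + p.2}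
  have hepi : Convex ℝ epi := by
    simpa using hf.convex_epigraph.translate_preimage_right (x, f x)
  have hmem (y : E) (r : ℝ) (hr : f (x + y) - f x ≤ r) : (y, r) ∈ ConvexCone.hull ℝ epi :=
    ConvexCone.subset_hull (sub_le_iff_le_add'.1 hr)
  have hne : ((0, 1) : E × ℝ) ≠ 0 := by simp
  let C : PointedCone ℝ (E × ℝ) := (ConvexCone.hull ℝ epi).toPointedCone (hmem 0 0 (by simp))
  let φ : E × ℝ →ₗ.[ℝ] ℝ := LinearPMap.mkSpanSingleton (0, 1) (1 : ℝ) hne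
  have hφ : ∀ p : φ.domain, (p : E × ℝ) ∈ C → 0 ≤ φ p := by
    rintro ⟨p, hp⟩ hcone
    obtain ⟨r, rfl⟩ := Submodule.mem_span_singleton.1 hp
    have hr : 0 ≤ r := nonneg_of_mk_zero_mem_hull hepi (fun s hs => by simpa [epi] using hs)
      (by simpa using (ConvexCone.mem_toPointedCone _ _).1 hcone)
    have happly : φ ⟨r • (0, 1), hp⟩ = r • (1 : ℝ) := LinearPMap.mkSpanSingleton'_apply ..
    rwa [happly, smul_eq_mul, mul_one]
  have hcofinal : ∀ p : E × ℝ, ∃ q : φ.domain, (q : E × ℝ) + p ∈ C := by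
    rintro ⟨y, r⟩
    refine ⟨⟨(f (x + y) - f x - r) • (0, 1), Submodule.smul_mem _ _
      (Submodule.mem_span_singleton_self _)⟩, ?_⟩
    refine (ConvexCone.mem_toPointedCone _ _).2 ?_
    simpa using hmem y _ le_rfl
  obtain ⟨g, hg, hnonneg⟩ := riesz_extension C φ hφ hcofinal
  have hg1 : g (0, 1) = 1 :=
    (hg ⟨(0, 1), Submodule.mem_span_singleton_self _⟩).trans
      (LinearPMap.mkSpanSingleton_apply ℝ ℝ hne (1 : ℝ))
  refine ⟨-g.comp (LinearMap.inl ℝ E ℝ), fun y => ?_⟩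
  have hsplit : (y, f (x + y) - f x) = (y, 0) + (f (x + y) - f x) • ((0, 1) : E × ℝ) := by simp
  have h0 := hnonneg _ (hmem y _ le_rfl)
  rw [hsplit, map_add, map_smul, hg1, smul_eq_mul, mul_one] at h0
  simp only [LinearMap.neg_apply, LinearMap.comp_apply, LinearMap.inl_apply]
  linarith

section UpperEnvelope

variable {α : Type*} [PseudoMetricSpace α] {f : α → ℝ}

/-- The least `K`-Lipschitz function above `f`, as long as `f` is bounded above. -/
noncomputable def lipschitzEnvelope (f : α → ℝ) (K : ℝ≥0) (x : α) : ℝ := ⨆ y, (f y - K * dist x y)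

theorem bddAbove_range_sub_mul_dist (hf : BddAbove (range f)) (K : ℝ≥0) (x : α) :
    BddAbove (range fun y => f y - K * dist x y) :=
  hf.range_mono _ fun _ => sub_le_self _ (by positivity)

theorem le_lipschitzEnvelope (hf : BddAbove (range f)) (K : ℝ≥0) (x : α) :
    f x ≤ lipschitzEnvelope f K x := by
  simpa [lipschitzEnvelope] using le_ciSup (bddAbove_range_sub_mul_dist hf K x) x

theorem lipschitzEnvelope_le {K : ℝ≥0} {x : α} {b : ℝ} (h : ∀ y, f y - K * dist x y ≤ b) :
    lipschitzEnvelope f K x ≤ b :=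
  have : Nonempty α := ⟨x⟩
  ciSup_le h

theorem abs_lipschitzEnvelope_le {c : ℝ} (hc : ∀ x, |f x| ≤ c) (K : ℝ≥0) (x : α) :
    |lipschitzEnvelope f K x| ≤ c := by
  have hbdd : BddAbove (range f) := ⟨c, forall_mem_range.2 fun y => (abs_le.1 (hc y)).2⟩
  refine abs_le.2 ⟨(abs_le.1 (hc x)).1.trans (le_lipschitzEnvelope hbdd K x),
    lipschitzEnvelope_le fun y => (sub_le_self _ (by positivity)).trans (abs_le.1 (hc y)).2⟩

theorem lipschitzWith_lipschitzEnvelope (hf : BddAbove (range f)) (K : ℝ≥0) :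
    LipschitzWith K (lipschitzEnvelope f K) := by
  refine LipschitzWith.of_le_add_mul K fun x x' => lipschitzEnvelope_le fun y => ?_
  calc f y - K * dist x y ≤ f y - K * (dist x' y - dist x x') := by
        gcongr
        linarith [dist_triangle_left x' y x]
    _ = f y - K * dist x' y + K * dist x x' := by ring
    _ ≤ lipschitzEnvelope f K x' + K * dist x x' := by
        gcongr
        exact le_ciSup (bddAbove_range_sub_mul_dist hf K x') y

theorem tendsto_lipschitzEnvelope (hf : BddAbove (range f)) {x : α}
    (hx : UpperSemicontinuousAt f x) :
    Tendsto (fun n : ℕ => lipschitzEnvelope f n x) atTop (𝓝 (f x)) := by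
  refine tendsto_order.2 ⟨fun a ha => .of_forall fun n => ha.trans_le (le_lipschitzEnvelope hf n x),
    fun a ha => ?_⟩
  obtain ⟨c, hc⟩ := hf
  obtain ⟨b, hxb, hba⟩ := exists_between ha
  obtain ⟨δ, hδ, hnear⟩ := Metric.eventually_nhds_iff.1 (hx b hxb)
  obtain ⟨N, hN⟩ := exists_nat_ge ((c - b) / δ)
  filter_upwards [eventually_ge_atTop N] with n hn
  refine (lipschitzEnvelope_le fun y => ?_).trans_lt hba
  rcases lt_or_ge (dist y x) δ with hy | hy
  · exact (sub_le_self _ (by positivity)).trans (hnear hy).le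
  · have hfar : c - b ≤ n * dist x y :=
      calc c - b ≤ N * δ := (div_le_iff₀ hδ).1 hN
        _ ≤ n * dist x y := by rw [dist_comm]; gcongr
    have hfy : f y ≤ c := hc (mem_range_self y)
    push_cast
    linarith

end UpperEnvelope

section WeightedSpaces

variable {Ω : Type*} [MeasurableSpace Ω] {Z : Ω → ℝ}

theorem mem_BZ_of_abs_le (hZ : ∀ ω, 0 < Z ω) {X : Ω → ℝ} (hX : Measurable X) {c : ℝ}
    (hc : ∀ ω, |X ω| ≤ c * Z ω) : X ∈ BZ Z :=
  ⟨hX, c, fun ω => by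
    rw [abs_div, abs_of_pos (hZ ω), div_le_iff₀ (hZ ω)]
    exact hc ω⟩

theorem exists_abs_le_mul_of_mem_BZ (hZ : ∀ ω, 0 < Z ω) {X : Ω → ℝ} (hX : X ∈ BZ Z) :
    ∃ c, 0 ≤ c ∧ ∀ ω, |X ω| ≤ c * Z ω := by
  obtain ⟨-, c, hc⟩ := hX
  refine ⟨max c 0, le_max_right c 0, fun ω => ?_⟩
  have hω := hc ω
  rw [abs_div, abs_of_pos (hZ ω), div_le_iff₀ (hZ ω)] at hω
  exact hω.trans (mul_le_mul_of_nonneg_right (le_max_left c 0) (hZ ω).le)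

/-- `B_Z` as a linear subspace of the space of all functions. -/
def weightedMeasurable (Z : Ω → ℝ) : Submodule ℝ (Ω → ℝ) where
  carrier := BZ Z
  zero_mem' := ⟨measurable_const, 0, by simp⟩
  add_mem' := by
    rintro X Y ⟨hX, c, hXc⟩ ⟨hY, d, hYd⟩
    refine ⟨hX.add hY, c + d, fun ω => ?_⟩
    rw [Pi.add_apply, add_div]
    exact (abs_add_le _ _).trans (add_le_add (hXc ω) (hYd ω))
  smul_mem' := by
    rintro a X ⟨hX, c, hXc⟩
    refine ⟨hX.const_smul a, |a| * c, fun ω => ?_⟩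
    rw [Pi.smul_apply, smul_eq_mul, mul_div_assoc, abs_mul]
    gcongr
    exact hXc ω

theorem integrable_of_mem_BZ (hZ : ∀ ω, 0 < Z ω) {X : Ω → ℝ} (hX : X ∈ BZ Z) {P : Measure Ω}
    (hP : Integrable Z P) : Integrable X P := by
  obtain ⟨c, -, hc⟩ := exists_abs_le_mul_of_mem_BZ hZ hX
  exact (hP.const_mul c).mono' (Measurable.aestronglyMeasurable hX.1) (ae_of_all _ hc)

variable [TopologicalSpace Ω]

theorem CZ_subset_UZ : CZ Z ⊆ UZ Z := fun _ hX => ⟨hX.1, hX.2.upperSemicontinuous⟩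

/-- `C_Z` as a linear subspace of the space of all functions. -/
def weightedContinuous (Z : Ω → ℝ) : Submodule ℝ (Ω → ℝ) where
  carrier := CZ Z
  zero_mem' := ⟨(weightedMeasurable Z).zero_mem, continuous_const⟩
  add_mem' hX hY := ⟨(weightedMeasurable Z).add_mem hX.1 hY.1, hX.2.add hY.2⟩
  smul_mem' a _ hX := ⟨(weightedMeasurable Z).smul_mem a hX.1, hX.2.const_smul a⟩

theorem weightedContinuous_le (Z : Ω → ℝ) :
    weightedContinuous Z ≤ weightedMeasurable Z := fun _ hX => hX.1

variable [OpensMeasurableSpace Ω]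

theorem mem_CZ_of_abs_le (hZ : ∀ ω, 0 < Z ω) {X : Ω → ℝ} (hX : Continuous X) {c : ℝ}
    (hc : ∀ ω, |X ω| ≤ c * Z ω) : X ∈ CZ Z :=
  ⟨mem_BZ_of_abs_le hZ hX.measurable hc, hX⟩

theorem mem_CZ_of_abs_le_const (hZ : ∀ ω, 1 ≤ Z ω) {X : Ω → ℝ} (hX : Continuous X) {c : ℝ}
    (hc : ∀ ω, |X ω| ≤ c) : X ∈ CZ Z :=
  mem_CZ_of_abs_le (fun ω => one_pos.trans_le (hZ ω)) hX fun ω =>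
    (hc ω).trans (le_mul_of_one_le_right ((abs_nonneg _).trans (hc ω)) (hZ ω))

/-- The constant function `a` as an element of `C_Z`. -/
def const (hZ : ∀ ω, 1 ≤ Z ω) (a : ℝ) : weightedContinuous Z :=
  ⟨fun _ => a, mem_CZ_of_abs_le_const hZ continuous_const fun _ => le_rfl⟩

/-- The weight `Z` as an element of `C_Z`. -/
def weight (hZ : ∀ ω, 1 ≤ Z ω) (hZc : Continuous Z) : weightedContinuous Z :=
  ⟨Z, mem_CZ_of_abs_le (c := 1) (fun ω => one_pos.trans_le (hZ ω)) hZc fun ω => by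
    rw [one_mul, abs_of_pos (one_pos.trans_le (hZ ω))]⟩

/-- The payoff `(Z - z)⁺` of a call option on `Z` with strike `z`, as an element of `C_Z`. -/
def call (hZ : ∀ ω, 1 ≤ Z ω) (hZc : Continuous Z) (z : ℝ) : weightedContinuous Z :=
  ⟨fun ω => max (Z ω - z) 0, mem_CZ_of_abs_le (c := 1 + |z|) (fun ω => one_pos.trans_le (hZ ω))
    (by fun_prop) fun ω => by
      rw [abs_of_nonneg (le_max_right _ _)]
      have hz : |z| ≤ |z| * Z ω := le_mul_of_one_le_right (abs_nonneg z) (hZ ω)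
      have hZω := hZ ω
      exact max_le (by linarith [neg_abs_le z]) (by positivity)⟩

end WeightedSpaces

section Representation

variable {Ω : Type*} {Z : Ω → ℝ}

/-- A cutoff function that equals `1` on `{Z ≤ k}` and vanishes outside `{Z ≤ k + 1}`. -/
def cutoff (Z : Ω → ℝ) (k : ℕ) (ω : Ω) : ℝ := max 0 (min 1 (k + 1 - Z ω))

theorem cutoff_nonneg (k : ℕ) (ω : Ω) : 0 ≤ cutoff Z k ω := le_max_left _ _

theorem cutoff_le_one (k : ℕ) (ω : Ω) : cutoff Z k ω ≤ 1 := max_le zero_le_one (min_le_left _ _)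

theorem cutoff_eq_one {k : ℕ} {ω : Ω} (h : Z ω ≤ k) : cutoff Z k ω = 1 := by
  rw [cutoff, min_eq_left (by linarith), max_eq_right zero_le_one]

theorem cutoff_eq_zero {k : ℕ} {ω : Ω} (h : k + 1 ≤ Z ω) : cutoff Z k ω = 0 :=
  max_eq_left ((min_le_right _ _).trans (by linarith))

theorem eventually_cutoff_eq_one (ω : Ω) : ∀ᶠ k : ℕ in atTop, cutoff Z k ω = 1 :=
  (tendsto_natCast_atTop_atTop.eventually_ge_atTop (Z ω)).mono fun _ hk => cutoff_eq_one hk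

theorem abs_mul_cutoff_le (k : ℕ) (x : ℝ) (ω : Ω) : |x * cutoff Z k ω| ≤ |x| := by
  rw [abs_mul, abs_of_nonneg (cutoff_nonneg k ω)]
  exact mul_le_of_le_one_right (abs_nonneg x) (cutoff_le_one k ω)

theorem abs_sub_mul_cutoff_le {k : ℕ} {x c : ℝ} {ω : Ω} (hc : 0 ≤ c) (hx : |x| ≤ c * Z ω) :
    |x - x * cutoff Z k ω| ≤ 2 * c * max (Z ω - k / 2) 0 := by
  rcases le_or_gt (Z ω) k with hk | hk
  · rw [cutoff_eq_one hk, mul_one, sub_self, abs_zero]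
    positivity
  · calc |x - x * cutoff Z k ω| = |x| * (1 - cutoff Z k ω) := by
          rw [← abs_of_nonneg (sub_nonneg.2 (cutoff_le_one k ω)), ← abs_mul, mul_sub, mul_one]
      _ ≤ |x| := mul_le_of_le_one_right (abs_nonneg x) (sub_le_self _ (cutoff_nonneg k ω))
      _ ≤ c * Z ω := hx
      _ ≤ c * (2 * max (Z ω - k / 2) 0) := by
          gcongr
          linarith [le_max_left (Z ω - k / 2) 0]
      _ = 2 * c * max (Z ω - k / 2) 0 := by ring

variable [TopologicalSpace Ω]

theorem weaklyLocallyCompactSpace_of_isCompact_sublevel (hZc : Continuous Z)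
    (hcomp : ∀ z : ℝ, 0 ≤ z → IsCompact {ω | Z ω ≤ z}) : WeaklyLocallyCompactSpace Ω :=
  ⟨fun x => ⟨{ω | Z ω ≤ |Z x| + 1}, hcomp _ (by positivity),
    hZc.tendsto x (Iic_mem_nhds (by linarith [le_abs_self (Z x)]))⟩⟩

theorem continuous_cutoff (hZc : Continuous Z) (k : ℕ) : Continuous (cutoff Z k) := by
  unfold cutoff
  fun_prop

theorem hasCompactSupport_cutoff [R1Space Ω] (hcomp : ∀ z : ℝ, 0 ≤ z → IsCompact {ω | Z ω ≤ z})
    (k : ℕ) : HasCompactSupport (cutoff Z k) :=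
  .intro (hcomp (k + 1) (by positivity)) fun _ hω => cutoff_eq_zero (not_le.1 hω).le

variable [MeasurableSpace Ω]

section Approximation

variable [OpensMeasurableSpace Ω]

/-- The inclusion of the compactly supported continuous functions into `C_Z`. -/
def ofCompactSupport (hZ : ∀ ω, 1 ≤ Z ω) : C_c(Ω, ℝ) →ₗ[ℝ] weightedContinuous Z where
  toFun f := ⟨f, (f.hasCompactSupport.exists_bound_of_continuous f.continuous).elim fun _ hc =>
    mem_CZ_of_abs_le_const hZ f.continuous hc⟩
  map_add' _ _ := rfl
  map_smul' _ _ := rfl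

/-- The compactly supported approximation `W * cutoff Z k` of an element `W` of `C_Z`. -/
def truncate [R1Space Ω] (hZc : Continuous Z)
    (hcomp : ∀ z : ℝ, 0 ≤ z → IsCompact {ω | Z ω ≤ z}) (W : weightedContinuous Z) (k : ℕ) :
    C_c(Ω, ℝ) :=
  ⟨⟨fun ω => W.1 ω * cutoff Z k ω, W.2.2.mul (continuous_cutoff hZc k)⟩,
    (hasCompactSupport_cutoff hcomp k).mul_left⟩

theorem tendsto_apply_truncate [R1Space Ω] (hZ : ∀ ω, 1 ≤ Z ω) (hZc : Continuous Z)
    (hcomp : ∀ z : ℝ, 0 ≤ z → IsCompact {ω | Z ω ≤ z}) (l : weightedContinuous Z →ₚ[ℝ] ℝ)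
    (htight : Tendsto (fun z => l (call hZ hZc z)) atTop (𝓝 0)) (W : weightedContinuous Z) :
    Tendsto (fun k => l (ofCompactSupport hZ (truncate hZc hcomp W k))) atTop (𝓝 (l W)) := by
  obtain ⟨c, hc, hWc⟩ := exists_abs_le_mul_of_mem_BZ (fun ω => one_pos.trans_le (hZ ω)) W.2.1
  have hbound (k : ℕ) : ‖l (ofCompactSupport hZ (truncate hZc hcomp W k)) - l W‖
      ≤ 2 * c * l (call hZ hZc (k / 2)) := by
    have hle (ω : Ω) := abs_le.1 (abs_sub_mul_cutoff_le (k := k) hc (hWc ω))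
    have hsub : l (W - ofCompactSupport hZ (truncate hZc hcomp W k))
        ≤ l ((2 * c) • call hZ hZc (k / 2)) := OrderHomClass.mono l fun ω => (hle ω).2
    have hneg : l (-((2 * c) • call hZ hZc (k / 2)))
        ≤ l (W - ofCompactSupport hZ (truncate hZc hcomp W k)) :=
      OrderHomClass.mono l fun ω => (hle ω).1
    rw [map_neg] at hneg
    simp only [map_sub, map_smul, smul_eq_mul] at hsub hneg
    rw [Real.norm_eq_abs, abs_sub_comm]
    exact abs_le.2 ⟨hneg, hsub⟩
  have hhalf : Tendsto (fun k : ℕ => (k : ℝ) / 2) atTop atTop :=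
    tendsto_natCast_atTop_atTop.atTop_div_const two_pos
  refine tendsto_iff_norm_sub_tendsto_zero.2 (squeeze_zero (fun _ => norm_nonneg _) hbound ?_)
  simpa using (htight.comp hhalf).const_mul (2 * c)

theorem integrable_weight_of_forall_integral_eq [T2Space Ω] (hZ : ∀ ω, 1 ≤ Z ω)
    (hZc : Continuous Z) (hcomp : ∀ z : ℝ, 0 ≤ z → IsCompact {ω | Z ω ≤ z})
    (l : weightedContinuous Z →ₚ[ℝ] ℝ) {P : Measure Ω} [IsFiniteMeasureOnCompacts P]
    (hP : ∀ f : C_c(Ω, ℝ), ∫ ω, f ω ∂P = l (ofCompactSupport hZ f)) : Integrable Z P := by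
  have hZ0 (ω : Ω) : 0 ≤ Z ω := zero_le_one.trans (hZ ω)
  have hmeas (k : ℕ) : MeasurableSet {ω | Z ω ≤ k} := measurableSet_le hZc.measurable (by fun_prop)
  have hcover : AECover P atTop fun k : ℕ => {ω | Z ω ≤ k} :=
    ⟨ae_of_all _ fun ω => tendsto_natCast_atTop_atTop.eventually_ge_atTop (Z ω), hmeas⟩
  refine hcover.integrable_of_integral_bounded_of_nonneg_ae (l (weight hZ hZc))
    (fun k => hZc.continuousOn.integrableOn_compact (hcomp k k.cast_nonneg)) (ae_of_all _ hZ0)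
    (.of_forall fun k => ?_)
  let f : C_c(Ω, ℝ) := truncate hZc hcomp (weight hZ hZc) k
  have hf0 (ω : Ω) : 0 ≤ f ω := mul_nonneg (hZ0 ω) (cutoff_nonneg k ω)
  have hfZ (ω : Ω) : f ω ≤ Z ω := mul_le_of_le_one_right (hZ0 ω) (cutoff_le_one k ω)
  calc ∫ ω in {ω | Z ω ≤ k}, Z ω ∂P = ∫ ω in {ω | Z ω ≤ k}, f ω ∂P :=
        setIntegral_congr_fun (hmeas k) fun ω (hω : Z ω ≤ k) =>
          (by simp [f, truncate, weight, cutoff_eq_one hω])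
    _ ≤ ∫ ω, f ω ∂P := setIntegral_le_integral
        (f.continuous.integrable_of_hasCompactSupport f.hasCompactSupport) (ae_of_all _ hf0)
    _ = l (ofCompactSupport hZ f) := hP f
    _ ≤ l (weight hZ hZc) := OrderHomClass.mono l hfZ

theorem integral_eq_of_forall_integral_eq [R1Space Ω] (hZ : ∀ ω, 1 ≤ Z ω)
    (hZc : Continuous Z) (hcomp : ∀ z : ℝ, 0 ≤ z → IsCompact {ω | Z ω ≤ z})
    (l : weightedContinuous Z →ₚ[ℝ] ℝ)
    (htight : Tendsto (fun z => l (call hZ hZc z)) atTop (𝓝 0)) {P : Measure Ω}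
    (hPZ : Integrable Z P) (hP : ∀ f : C_c(Ω, ℝ), ∫ ω, f ω ∂P = l (ofCompactSupport hZ f))
    (W : weightedContinuous Z) : ∫ ω, W.1 ω ∂P = l W := by
  have hlim : Tendsto (fun k => ∫ ω, truncate hZc hcomp W k ω ∂P) atTop (𝓝 (∫ ω, W.1 ω ∂P)) := by
    refine tendsto_integral_of_dominated_convergence (fun ω => |W.1 ω|)
      (fun k => (map_continuous (truncate hZc hcomp W k)).aestronglyMeasurable)
      (integrable_of_mem_BZ (fun ω => one_pos.trans_le (hZ ω)) W.2.1 hPZ).abs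
      (fun k => ae_of_all _ fun ω => abs_mul_cutoff_le k _ ω)
      (ae_of_all _ fun ω => tendsto_const_nhds.congr' ?_)
    filter_upwards [eventually_cutoff_eq_one (Z := Z) ω] with k hk
    simp [truncate, hk]
  exact tendsto_nhds_unique hlim
    (by simpa only [hP] using tendsto_apply_truncate hZ hZc hcomp l htight W)

end Approximation

theorem exists_measure_integral_eq [T2Space Ω] [BorelSpace Ω] (hZ : ∀ ω, 1 ≤ Z ω)
    (hZc : Continuous Z) (hcomp : ∀ z : ℝ, 0 ≤ z → IsCompact {ω | Z ω ≤ z})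
    (l : weightedContinuous Z →ₚ[ℝ] ℝ) (hone : l (const hZ 1) = 1)
    (htight : Tendsto (fun z => l (call hZ hZc z)) atTop (𝓝 0)) :
    ∃ P ∈ PZ Z, ∀ W : weightedContinuous Z, ∫ ω, W.1 ω ∂P = l W := by
  have := weaklyLocallyCompactSpace_of_isCompact_sublevel hZc hcomp
  let Λ : C_c(Ω, ℝ) →ₚ[ℝ] ℝ :=
    .mk₀ (l.toLinearMap ∘ₗ ofCompactSupport hZ) fun f hf =>
      map_nonneg l (a := ofCompactSupport hZ f) hf
  let P : Measure Ω := RealRMK.rieszMeasure Λ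
  have hP (f : C_c(Ω, ℝ)) : ∫ ω, f ω ∂P = l (ofCompactSupport hZ f) :=
    RealRMK.integral_rieszMeasure Λ f
  have hPZ : Integrable Z P := integrable_weight_of_forall_integral_eq hZ hZc hcomp l hP
  have hrep := integral_eq_of_forall_integral_eq hZ hZc hcomp l htight hPZ hP
  have hmass : P.real univ = 1 := by
    rw [← hone, ← hrep (const hZ 1)]
    simp [const]
  exact ⟨P, ⟨⟨(ENNReal.toReal_eq_one_iff _).1 hmass⟩, hPZ⟩, hrep⟩

end Representation

section Subgradient

variable {E : Type*} [AddCommGroup E] [Module ℝ E] {f : E → ℝ} {x : E} {l : E →ₗ[ℝ] ℝ}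

theorem subgradient_nonneg_of_monotone [Preorder E] [IsOrderedAddMonoid E] (hf : Monotone f)
    (hl : ∀ y, l y ≤ f (x + y) - f x) {y : E} (hy : 0 ≤ y) : 0 ≤ l y := by
  have hdecrease : f (x + -y) ≤ f x := hf (by simpa using hy)
  have hneg := hl (-y)
  rw [map_neg] at hneg
  linarith

theorem subgradient_apply_eq_one (hl : ∀ y, l y ≤ f (x + y) - f x) {e : E}
    (he : ∀ c : ℝ, f (x + c • e) ≤ f x + c) : l e = 1 := by
  have hupper := (hl ((1 : ℝ) • e)).trans (sub_le_iff_le_add'.2 (he 1))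
  have hlower := (hl ((-1 : ℝ) • e)).trans (sub_le_iff_le_add'.2 (he (-1)))
  rw [map_smul, smul_eq_mul] at hupper hlower
  linarith

theorem subgradient_le_of_convexOn (hf : ConvexOn ℝ univ f) (hl : ∀ y, l y ≤ f (x + y) - f x)
    (y : E) : l y ≤ (f ((2 : ℝ) • x) + f ((2 : ℝ) • y)) / 2 - f x := by
  have hmid := hf.2 (mem_univ ((2 : ℝ) • x)) (mem_univ ((2 : ℝ) • y))
    one_half_pos.le one_half_pos.le (add_halves (1 : ℝ))
  rw [smul_smul, smul_smul, one_div_mul_cancel two_ne_zero, one_smul, one_smul, smul_eq_mul,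
    smul_eq_mul] at hmid
  linarith [hl y]

end Subgradient

section WeightedSubgradient

variable {Ω : Type*} [TopologicalSpace Ω] [MeasurableSpace Ω] {Z : Ω → ℝ}

/-- The inclusion of `C_Z` into `B_Z`. -/
abbrev toWeightedMeasurable : weightedContinuous Z →ₗ[ℝ] weightedMeasurable Z :=
  Submodule.inclusion (weightedContinuous_le Z)

section Call

variable [OpensMeasurableSpace Ω]

theorem call_antitone (hZ : ∀ ω, 1 ≤ Z ω) (hZc : Continuous Z) : Antitone (call hZ hZc) :=
  fun _ _ hz _ => max_le_max (sub_le_sub_left hz _) le_rfl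

theorem call_nonneg (hZ : ∀ ω, 1 ≤ Z ω) (hZc : Continuous Z) (z : ℝ) : 0 ≤ call hZ hZc z :=
  fun _ => le_max_right _ _

theorem tendsto_apply_call (hZ : ∀ ω, 1 ≤ Z ω) (hZc : Continuous Z)
    (l : weightedContinuous Z →ₚ[ℝ] ℝ) {C : ℝ}
    (hC : ∀ n : ℕ, 0 < n → ∃ z, l ((n : ℝ) • call hZ hZc z) ≤ C) :
    Tendsto (fun z => l (call hZ hZc z)) atTop (𝓝 0) := by
  refine tendsto_order.2 ⟨fun a ha => .of_forall fun z =>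
    ha.trans_le (map_nonneg l (call_nonneg hZ hZc z)), fun a ha => ?_⟩
  obtain ⟨n, hn⟩ := exists_nat_gt (max (C / a) 0)
  have hn0 : (0 : ℝ) < n := (le_max_right _ _).trans_lt hn
  have hnC : C < n * a := (div_lt_iff₀ ha).1 ((le_max_left _ _).trans_lt hn)
  obtain ⟨z, hz⟩ := hC n (Nat.cast_pos.1 hn0)
  rw [map_smul, smul_eq_mul] at hz
  filter_upwards [eventually_ge_atTop z] with y hy
  exact (OrderHomClass.mono l (call_antitone hZ hZc hy)).trans_lt
    (lt_of_mul_lt_mul_left (hz.trans_lt hnC) hn0.le)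

end Call

theorem exists_measure_integral_le_sub [T2Space Ω] [BorelSpace Ω] (hZ : ∀ ω, 1 ≤ Z ω)
    (hZc : Continuous Z)
    (hcomp : ∀ z : ℝ, 0 ≤ z → IsCompact {ω | Z ω ≤ z}) {f : weightedMeasurable Z → ℝ}
    (hconv : ConvexOn ℝ univ f) (hmono : Monotone f)
    (hconst : ∀ X c, f (X + toWeightedMeasurable (const hZ c)) ≤ f X + c)
    (hcall : ∀ n : ℕ, 0 < n → ∃ z, f (toWeightedMeasurable ((n : ℝ) • call hZ hZc z)) ≤ 1)
    (X : weightedMeasurable Z) :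
    ∃ P ∈ PZ Z, ∀ W : weightedContinuous Z,
      ∫ ω, W.1 ω ∂P ≤ f (X + toWeightedMeasurable W) - f X := by
  obtain ⟨l, hl⟩ := exists_linearMap_le_sub_of_convexOn hconv X
  let lC : weightedContinuous Z →ₚ[ℝ] ℝ := .mk₀ (l ∘ₗ toWeightedMeasurable) fun W hW =>
    subgradient_nonneg_of_monotone hmono hl (y := toWeightedMeasurable W) hW
  have hone : lC (const hZ 1) = 1 := subgradient_apply_eq_one hl fun c => by
    have hsmul : c • toWeightedMeasurable (const hZ 1) = toWeightedMeasurable (const hZ c) := by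
      ext ω
      simp [const]
    rw [hsmul]
    exact hconst X c
  have htight : Tendsto (fun z => lC (call hZ hZc z)) atTop (𝓝 0) := by
    refine tendsto_apply_call hZ hZc lC (C := (f ((2 : ℝ) • X) + 1) / 2 - f X) fun n hn => ?_
    obtain ⟨z, hz⟩ := hcall (2 * n) (by positivity)
    refine ⟨z, (subgradient_le_of_convexOn hconv hl _).trans ?_⟩
    rw [Nat.cast_mul, Nat.cast_ofNat, mul_smul, map_smul] at hz
    gcongr
  obtain ⟨P, hP, hrep⟩ := exists_measure_integral_eq hZ hZc hcomp lC hone htight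
  exact ⟨P, hP, fun W => (hrep W).trans_le (hl (toWeightedMeasurable W))⟩

end WeightedSubgradient

section Superhedging

variable {Ω : Type*} {Z : Ω → ℝ} {G A : Set (Ω → ℝ)} {X Y : Ω → ℝ}

theorem mem_sub_iff_neg_mem_sub : X ∈ G - A ↔ -X ∈ A - G := by
  rw [← neg_sub A G, Set.mem_neg]

theorem phi_le_coe {m : ℝ} (h : (fun ω => m - X ω) ∈ A - G) : phi G A X ≤ m :=
  sInf_le ⟨m, h, rfl⟩

theorem phi_le_zero_of_mem (hX : X ∈ G - A) : phi G A X ≤ 0 :=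
  phi_le_coe (m := 0) (by simpa [← Pi.neg_def] using mem_sub_iff_neg_mem_sub.1 hX)

theorem exists_phi_call_le (hcall : CallCondition Z G A) {n : ℕ} (hn : 0 < n) :
    ∃ z : ℝ, phi G A (fun ω => n * max (Z ω - z) 0) ≤ (1 / n : ℝ) := by
  obtain ⟨z, -, hz⟩ := hcall n hn
  refine ⟨z, phi_le_coe ?_⟩
  convert mem_sub_iff_neg_mem_sub.1 hz using 1
  ext ω
  simp

variable [MeasurableSpace Ω]

/-- A convex set of acceptable net positions: a convex set of measurable functions that contains
`0` and every measurable function above one of its elements. The relevant instance is `A - G`. -/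
structure IsAcceptanceSet (S : Set (Ω → ℝ)) : Prop where
  measurable : ∀ {X : Ω → ℝ}, X ∈ S → Measurable X
  convex : Convex ℝ S
  mem_of_le : ∀ {X Y : Ω → ℝ}, X ∈ S → Measurable Y → (∀ ω, X ω ≤ Y ω) → Y ∈ S
  zero_mem : (0 : Ω → ℝ) ∈ S

theorem isAcceptanceSet_sub (hGB : G ⊆ B Ω) (hG0 : (0 : Ω → ℝ) ∈ G) (hAB : A ⊆ B Ω)
    (hBA : BPlus Ω ⊆ A) (hAadd : A + BPlus Ω ⊆ A) (hconv : Convex ℝ (A - G)) :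
    IsAcceptanceSet (A - G) := by
  have hmeas {X : Ω → ℝ} (hX : X ∈ A - G) : Measurable X := by
    obtain ⟨a, ha, g, hg, rfl⟩ := Set.mem_sub.1 hX
    exact Measurable.sub (hAB ha) (hGB hg)
  refine ⟨hmeas, hconv, fun {X Y} hX hY hXY => ?_,
    Set.mem_sub.2 ⟨0, hBA ⟨measurable_const, fun _ => le_rfl⟩, 0, hG0, sub_zero 0⟩⟩
  have hdiff : Y - X ∈ BPlus Ω := ⟨hY.sub (hmeas hX), fun ω => sub_nonneg.2 (hXY ω)⟩
  obtain ⟨a, ha, g, hg, rfl⟩ := Set.mem_sub.1 hX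
  exact Set.mem_sub.2 ⟨a + (Y - (a - g)), hAadd (Set.add_mem_add ha hdiff), g, hg, by abel⟩

namespace IsAcceptanceSet

theorem mem_sub_of_le (h : IsAcceptanceSet (A - G)) (hX : X ∈ G - A) (hY : Measurable Y)
    (hYX : ∀ ω, Y ω ≤ X ω) : Y ∈ G - A :=
  mem_sub_iff_neg_mem_sub.2 <|
    h.mem_of_le (mem_sub_iff_neg_mem_sub.1 hX) hY.neg fun ω => neg_le_neg (hYX ω)

theorem phi_le_coe_iff (h : IsAcceptanceSet (A - G)) (hX : Measurable X) {x : ℝ} :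
    phi G A X ≤ x ↔ ∀ m : ℝ, x < m → (fun ω => m - X ω) ∈ A - G := by
  refine ⟨fun hx m hm => ?_, fun hx => EReal.le_of_forall_lt_iff_le.1 fun m hm =>
    phi_le_coe (hx m (EReal.coe_lt_coe_iff.1 hm))⟩
  obtain ⟨_, ⟨r, hr, rfl⟩, hrm⟩ := sInf_lt_iff.1 (hx.trans_lt (EReal.coe_lt_coe_iff.2 hm))
  exact h.mem_of_le hr (hX.const_sub m) fun ω => sub_le_sub_right (EReal.coe_lt_coe_iff.1 hrm).le _

theorem phi_mono (h : IsAcceptanceSet (A - G)) (hX : Measurable X) (hXY : ∀ ω, X ω ≤ Y ω) :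
    phi G A X ≤ phi G A Y := by
  refine le_sInf ?_
  rintro _ ⟨m, hm, rfl⟩
  exact phi_le_coe (h.mem_of_le hm (hX.const_sub m) fun ω => sub_le_sub_left (hXY ω) m)

theorem phi_convex_le (h : IsAcceptanceSet (A - G)) (hX : Measurable X) (hY : Measurable Y)
    {x y a b : ℝ} (hx : phi G A X ≤ x) (hy : phi G A Y ≤ y) (ha : 0 ≤ a) (hb : 0 ≤ b)
    (hab : a + b = 1) : phi G A (a • X + b • Y) ≤ (a * x + b * y : ℝ) := by
  refine (h.phi_le_coe_iff ((hX.const_smul a).add (hY.const_smul b))).2 fun m hm => ?_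
  obtain ⟨ε, hε, rfl⟩ := exists_pos_add_of_lt' hm
  convert h.convex ((h.phi_le_coe_iff hX).1 hx (x + ε) (by linarith))
    ((h.phi_le_coe_iff hY).1 hy (y + ε) (by linarith)) ha hb hab using 1
  ext ω
  simp only [Pi.add_apply, Pi.smul_apply, smul_eq_mul]
  linear_combination (-ε) * hab

theorem phi_add_const_le (h : IsAcceptanceSet (A - G)) (hX : Measurable X) {x : ℝ}
    (hx : phi G A X ≤ x) (c : ℝ) : phi G A (X + fun _ => c) ≤ (x + c : ℝ) := by
  refine (h.phi_le_coe_iff (hX.add measurable_const)).2 fun m hm => ?_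
  convert (h.phi_le_coe_iff hX).1 hx (m - c) (by linarith) using 1
  ext ω
  simp only [Pi.add_apply]
  ring

theorem phi_zero_le (h : IsAcceptanceSet (A - G)) : phi G A 0 ≤ 0 :=
  phi_le_zero_of_mem (mem_sub_iff_neg_mem_sub.2 (by simpa using h.zero_mem))

theorem noUniformArbitrage_iff (h : IsAcceptanceSet (A - G)) :
    NoUniformArbitrage G A ↔ phi G A 0 = 0 := by
  refine ⟨fun hna => h.phi_zero_le.antisymm (le_sInf ?_), ?_⟩
  · rintro _ ⟨m, hm, rfl⟩
    by_contra! hneg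
    have hm0 : m < 0 := EReal.coe_neg'.1 hneg
    refine hna ⟨fun _ => -m, mem_sub_iff_neg_mem_sub.2 ?_, -m, neg_pos.2 hm0, fun _ => le_rfl⟩
    simpa [Pi.neg_def] using hm
  · rintro h0 ⟨X, hX, ε, hε, hXε⟩
    have hmem : (fun ω => -ε - (0 : Ω → ℝ) ω) ∈ A - G :=
      h.mem_of_le (mem_sub_iff_neg_mem_sub.1 hX) (by fun_prop) fun ω => by simpa using hXε ω
    have hle := phi_le_coe hmem
    rw [h0, ← EReal.coe_zero, EReal.coe_le_coe_iff] at hle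
    linarith

theorem exists_phi_le (h : IsAcceptanceSet (A - G)) (hZ : ∀ ω, 0 < Z ω)
    (hcall : CallCondition Z G A) (hX : X ∈ BZ Z) : ∃ m : ℝ, phi G A X ≤ m := by
  obtain ⟨c, -, hXc⟩ := exists_abs_le_mul_of_mem_BZ hZ hX
  obtain ⟨n, hn⟩ := exists_nat_gt (max c 0)
  have hn0 : (0 : ℝ) < n := (le_max_right _ _).trans_lt hn
  obtain ⟨z, -, hz⟩ := hcall n (Nat.cast_pos.1 hn0)
  refine ⟨1 / n + n * z, phi_le_coe (h.mem_of_le (mem_sub_iff_neg_mem_sub.1 hz)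
    (Measurable.const_sub hX.1 _) fun ω => ?_)⟩
  have hXn : X ω ≤ n * (Z ω - z) + n * z :=
    calc X ω ≤ c * Z ω := (le_abs_self _).trans (hXc ω)
      _ ≤ n * Z ω := mul_le_mul_of_nonneg_right ((le_max_left _ _).trans hn.le) (hZ ω).le
      _ = n * (Z ω - z) + n * z := by ring
  have hcallω : (n : ℝ) * (Z ω - z) ≤ n * max (Z ω - z) 0 := by
    gcongr
    exact le_max_left _ _
  simp only [Pi.neg_apply]
  linarith

theorem exists_phi_eq (h : IsAcceptanceSet (A - G)) (hZ : ∀ ω, 0 < Z ω)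
    (hcall : CallCondition Z G A) (h0 : phi G A 0 = 0) (hX : X ∈ BZ Z) :
    ∃ r : ℝ, phi G A X = r := by
  obtain ⟨u, hu⟩ := h.exists_phi_le hZ hcall hX
  obtain ⟨v, hv⟩ := h.exists_phi_le hZ hcall ((weightedMeasurable Z).neg_mem hX)
  have hlow : ((-v : ℝ) : EReal) ≤ phi G A X := by
    refine EReal.le_of_forall_lt_iff_le.1 fun x hx => ?_
    have hmid := h.phi_convex_le hX.1 (Measurable.neg hX.1) hx.le hv one_half_pos.le
      one_half_pos.le (add_halves 1)
    rw [smul_neg, add_neg_cancel, h0, ← EReal.coe_zero, EReal.coe_le_coe_iff] at hmid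
    exact EReal.coe_le_coe_iff.2 (by linarith)
  exact ⟨(phi G A X).toReal, (EReal.coe_toReal (hu.trans_lt (EReal.coe_lt_top u)).ne
    ((EReal.bot_lt_coe _).trans_le hlow).ne').symm⟩

end IsAcceptanceSet

/-- The restriction of `φ` to `B_Z` as a real function, which is meaningful only where `φ` is
finite. -/
noncomputable def phiReal (G A : Set (Ω → ℝ)) (X : weightedMeasurable Z) : ℝ :=
  (phi G A X.1).toReal

theorem coe_phiReal (hfin : ∀ X ∈ BZ Z, ∃ r : ℝ, phi G A X = r) (X : weightedMeasurable Z) :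
    (phiReal G A X : EReal) = phi G A X.1 := by
  obtain ⟨r, hr⟩ := hfin X.1 X.2
  rw [phiReal, hr, EReal.toReal_coe]

theorem phiReal_le_iff (hfin : ∀ X ∈ BZ Z, ∃ r : ℝ, phi G A X = r) {X : weightedMeasurable Z}
    {r : ℝ} : phiReal G A X ≤ r ↔ phi G A X.1 ≤ r := by
  rw [← coe_phiReal hfin, EReal.coe_le_coe_iff]

namespace IsAcceptanceSet

theorem convexOn_phiReal (h : IsAcceptanceSet (A - G))
    (hfin : ∀ X ∈ BZ Z, ∃ r : ℝ, phi G A X = r) :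
    ConvexOn ℝ univ (phiReal G A : weightedMeasurable Z → ℝ) :=
  ⟨convex_univ, fun X _ Y _ _ _ ha hb hab => (phiReal_le_iff hfin).2 <|
    h.phi_convex_le X.2.1 Y.2.1 (coe_phiReal hfin X).ge (coe_phiReal hfin Y).ge ha hb hab⟩

theorem monotone_phiReal (h : IsAcceptanceSet (A - G))
    (hfin : ∀ X ∈ BZ Z, ∃ r : ℝ, phi G A X = r) :
    Monotone (phiReal G A : weightedMeasurable Z → ℝ) := fun X Y hXY =>
  (phiReal_le_iff hfin).2 <| (h.phi_mono X.2.1 hXY).trans (coe_phiReal hfin Y).ge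

theorem phiReal_add_const_le [TopologicalSpace Ω] [OpensMeasurableSpace Ω]
    (h : IsAcceptanceSet (A - G)) (hZ : ∀ ω, 1 ≤ Z ω)
    (hfin : ∀ X ∈ BZ Z, ∃ r : ℝ, phi G A X = r) (X : weightedMeasurable Z) (c : ℝ) :
    phiReal G A (X + toWeightedMeasurable (const hZ c)) ≤ phiReal G A X + c :=
  (phiReal_le_iff hfin).2 <| h.phi_add_const_le X.2.1 (coe_phiReal hfin X).ge c

theorem exists_measure_integral_le_phiReal_sub [TopologicalSpace Ω] [T2Space Ω] [BorelSpace Ω]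
    (h : IsAcceptanceSet (A - G)) (hZ : ∀ ω, 1 ≤ Z ω) (hZc : Continuous Z)
    (hcomp : ∀ z : ℝ, 0 ≤ z → IsCompact {ω | Z ω ≤ z}) (hcall : CallCondition Z G A)
    (hfin : ∀ X ∈ BZ Z, ∃ r : ℝ, phi G A X = r) (X : weightedMeasurable Z) :
    ∃ P ∈ PZ Z, ∀ W : weightedContinuous Z,
      ∫ ω, W.1 ω ∂P ≤ phiReal G A (X + toWeightedMeasurable W) - phiReal G A X := by
  refine exists_measure_integral_le_sub hZ hZc hcomp (h.convexOn_phiReal hfin)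
    (h.monotone_phiReal hfin) (h.phiReal_add_const_le hZ hfin) (fun n hn => ?_) X
  obtain ⟨z, hz⟩ := exists_phi_call_le hcall hn
  refine ⟨z, (phiReal_le_iff hfin).2 (hz.trans (EReal.coe_le_coe_iff.2 ?_))⟩
  exact div_le_one_of_le₀ (Nat.one_le_cast.2 hn) n.cast_nonneg

end IsAcceptanceSet

end Superhedging

section ContinuousMajorants

variable {Ω : Type*} [TopologicalSpace Ω] {Z X : Ω → ℝ}

theorem upperSemicontinuous_div (hX : UpperSemicontinuous X) (hZc : Continuous Z)
    (hZ : ∀ ω, 0 < Z ω) : UpperSemicontinuous fun ω => X ω / Z ω := fun ω a ha => by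
  have husc : UpperSemicontinuous fun ω => X ω + -(a * Z ω) :=
    hX.add (by fun_prop : Continuous fun ω => -(a * Z ω)).upperSemicontinuous
  have hneg : X ω + -(a * Z ω) < 0 := by linarith [(div_lt_iff₀ (hZ ω)).1 ha]
  filter_upwards [husc ω 0 hneg] with y hy
  rw [div_lt_iff₀ (hZ y)]
  linarith

variable [MeasurableSpace Ω]

/-- The elements of `C_Z` that dominate `X`. -/
def continuousMajorants (Z X : Ω → ℝ) : Set (Ω → ℝ) := {Y | Y ∈ CZ Z ∧ ∀ ω, X ω ≤ Y ω}

theorem isLeast_image_continuousMajorants {β : Type*} [Preorder β] {F : (Ω → ℝ) → β}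
    (hX : X ∈ CZ Z) (hF : ∀ Y ∈ continuousMajorants Z X, F X ≤ F Y) :
    IsLeast (F '' continuousMajorants Z X) (F X) :=
  ⟨mem_image_of_mem F ⟨hX, fun _ => le_rfl⟩, forall_mem_image.2 hF⟩

theorem integral_le_of_mem_continuousMajorants (hZ : ∀ ω, 0 < Z ω) (hX : X ∈ BZ Z) {P : Measure Ω}
    (hP : Integrable Z P) {Y : Ω → ℝ} (hY : Y ∈ continuousMajorants Z X) :
    ∫ ω, X ω ∂P ≤ ∫ ω, Y ω ∂P :=
  integral_mono (integrable_of_mem_BZ hZ hX hP) (integrable_of_mem_BZ hZ hY.1.1 hP) hY.2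

theorem isGLB_integral_continuousMajorants [PseudoMetrizableSpace Ω] [OpensMeasurableSpace Ω]
    (hZ : ∀ ω, 0 < Z ω) (hZc : Continuous Z) (hX : X ∈ UZ Z) {P : Measure Ω}
    (hP : Integrable Z P) :
    IsGLB ((fun Y => ∫ ω, Y ω ∂P) '' continuousMajorants Z X) (∫ ω, X ω ∂P) := by
  let _ := TopologicalSpace.pseudoMetrizableSpacePseudoMetric Ω
  obtain ⟨c, hc⟩ := hX.1.2
  have hbdd : BddAbove (range fun ω => X ω / Z ω) :=
    ⟨c, forall_mem_range.2 fun ω => (abs_le.1 (hc ω)).2⟩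
  let Y (n : ℕ) (ω : Ω) : ℝ := Z ω * lipschitzEnvelope (fun ω => X ω / Z ω) n ω
  have hYc (n : ℕ) : Continuous (Y n) := hZc.mul (lipschitzWith_lipschitzEnvelope hbdd n).continuous
  have hYabs (n : ℕ) (ω : Ω) : |Y n ω| ≤ c * Z ω := by
    rw [abs_mul, abs_of_pos (hZ ω), mul_comm]
    exact mul_le_mul_of_nonneg_right (abs_lipschitzEnvelope_le hc n ω) (hZ ω).le
  have hXY (n : ℕ) (ω : Ω) : X ω ≤ Y n ω :=
    (div_le_iff₀' (hZ ω)).1 (le_lipschitzEnvelope hbdd n ω)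
  have hYlim (ω : Ω) : Tendsto (fun n => Y n ω) atTop (𝓝 (X ω)) := by
    have hlim := tendsto_lipschitzEnvelope hbdd (upperSemicontinuous_div hX.2 hZc hZ ω)
    simpa only [mul_div_cancel₀ _ (hZ ω).ne'] using hlim.const_mul (Z ω)
  refine isGLB_of_mem_closure
    (forall_mem_image.2 fun _ => integral_le_of_mem_continuousMajorants hZ hX.1 hP)
    (mem_closure_of_tendsto (f := fun n => ∫ ω, Y n ω ∂P) (b := atTop) ?_ (.of_forall fun n =>
      mem_image_of_mem _ ⟨mem_CZ_of_abs_le hZ (hYc n) (hYabs n), hXY n⟩))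
  exact tendsto_integral_of_dominated_convergence (fun ω => c * Z ω)
    (fun n => (hYc n).measurable.aestronglyMeasurable) (hP.const_mul c)
    (fun n => ae_of_all _ (hYabs n)) (ae_of_all _ hYlim)

end ContinuousMajorants

section Duality

variable {Ω : Type*} [TopologicalSpace Ω] [MeasurableSpace Ω] {Z X : Ω → ℝ} {G A : Set (Ω → ℝ)}

theorem integral_sub_phiStar_le (hX : X ∈ CZ Z) (P : Measure Ω) :
    ((∫ ω, X ω ∂P : ℝ) : EReal) - phiStar Z G A P ≤ phi G A X := by
  have hstar : ((∫ ω, X ω ∂P : ℝ) : EReal) - phi G A X ≤ phiStar Z G A P :=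
    le_iSup₂ (f := fun X (_ : X ∈ CZ Z) => ((∫ ω, X ω ∂P : ℝ) : EReal) - phi G A X) X hX
  refine (EReal.sub_le_sub le_rfl hstar).trans ?_
  induction phi G A X with
  | bot => simp
  | coe r => rw [← EReal.coe_sub, ← EReal.coe_sub, sub_sub_cancel]
  | top => exact le_top

theorem integral_sub_phiStar_le_of_majorants (hZ : ∀ ω, 0 < Z ω) (hX : X ∈ BZ Z)
    (hphi : phi G A X = sInf (phi G A '' continuousMajorants Z X)) {P : Measure Ω}
    (hP : Integrable Z P) : ((∫ ω, X ω ∂P : ℝ) : EReal) - phiStar Z G A P ≤ phi G A X := by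
  rw [hphi]
  refine le_sInf (forall_mem_image.2 fun Y hY => ?_)
  refine le_trans (EReal.sub_le_sub (EReal.coe_le_coe_iff.2 ?_) le_rfl)
    (integral_sub_phiStar_le hY.1 P)
  exact integral_le_of_mem_continuousMajorants hZ hX hP hY

namespace IsAcceptanceSet

theorem phiStar_le_of_forall_integral_le (h : IsAcceptanceSet (A - G)) (hZ : ∀ ω, 0 < Z ω)
    (hfin : ∀ X ∈ BZ Z, ∃ r : ℝ, phi G A X = r) (X : weightedMeasurable Z) {P : Measure Ω}
    (hPZ : Integrable Z P)
    (hglb : IsGLB ((fun Y => ∫ ω, Y ω ∂P) '' continuousMajorants Z X.1) (∫ ω, X.1 ω ∂P))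
    (hP : ∀ W : weightedContinuous Z,
      ∫ ω, W.1 ω ∂P ≤ phiReal G A (X + toWeightedMeasurable W) - phiReal G A X) :
    phiStar Z G A P ≤ (∫ ω, X.1 ω ∂P - phiReal G A X : ℝ) := by
  refine iSup₂_le fun V hV => ?_
  lift V to weightedContinuous Z using hV
  have hphiV : phi G A V.1 = phiReal G A (toWeightedMeasurable V) :=
    (coe_phiReal hfin (toWeightedMeasurable V)).symm
  rw [hphiV, ← EReal.coe_sub, EReal.coe_le_coe_iff, le_sub_iff_add_le]
  refine hglb.2 (forall_mem_image.2 fun Y hY => ?_)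
  lift Y to weightedContinuous Z using hY.1
  have hdiff : ∫ ω, (V - Y).1 ω ∂P = ∫ ω, V.1 ω ∂P - ∫ ω, Y.1 ω ∂P :=
    integral_sub (integrable_of_mem_BZ hZ V.2.1 hPZ) (integrable_of_mem_BZ hZ Y.2.1 hPZ)
  have hmono :
      phiReal G A (X + toWeightedMeasurable (V - Y)) ≤ phiReal G A (toWeightedMeasurable V) := by
    refine h.monotone_phiReal hfin ?_
    rw [map_sub, ← add_sub_assoc, sub_le_iff_le_add']
    exact add_le_add_left hY.2 _
  linarith [hP (V - Y)]

theorem hasDualFormula [T2Space Ω] [BorelSpace Ω] (h : IsAcceptanceSet (A - G))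
    (hZ : ∀ ω, 1 ≤ Z ω) (hZc : Continuous Z)
    (hcomp : ∀ z : ℝ, 0 ≤ z → IsCompact {ω | Z ω ≤ z}) (hcall : CallCondition Z G A)
    (h0 : phi G A 0 = 0) {D : Set (Ω → ℝ)} (hD : D ⊆ BZ Z)
    (hglb : ∀ X ∈ D, ∀ P ∈ PZ Z,
      IsGLB ((fun Y => ∫ ω, Y ω ∂P) '' continuousMajorants Z X) (∫ ω, X ω ∂P))
    (hphi : ∀ X ∈ D, phi G A X = sInf (phi G A '' continuousMajorants Z X)) :
    HasDualFormula Z G A D := by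
  have hZ0 (ω : Ω) : 0 < Z ω := one_pos.trans_le (hZ ω)
  have hfin (X : Ω → ℝ) (hX : X ∈ BZ Z) := h.exists_phi_eq hZ0 hcall h0 hX
  have hupper (X : Ω → ℝ) (hX : X ∈ D) (P : Measure Ω) (hP : P ∈ PZ Z) :
      ((∫ ω, X ω ∂P : ℝ) : EReal) - phiStar Z G A P ≤ phi G A X :=
    integral_sub_phiStar_le_of_majorants hZ0 (hD hX) (hphi X hX) hP.2
  refine ⟨hfin, h0, fun X hX => ⟨?_, forall_mem_image.2 (hupper X hX)⟩⟩
  let X' : weightedMeasurable Z := ⟨X, hD hX⟩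
  obtain ⟨P, hP, hle⟩ := h.exists_measure_integral_le_phiReal_sub hZ hZc hcomp hcall hfin X'
  refine ⟨P, hP, (hupper X hX P hP).antisymm ?_⟩
  calc phi G A X
      = ((∫ ω, X ω ∂P : ℝ) : EReal) - (∫ ω, X ω ∂P - phiReal G A X' : ℝ) := by
        rw [← EReal.coe_sub, sub_sub_cancel, coe_phiReal hfin X']
    _ ≤ ((∫ ω, X ω ∂P : ℝ) : EReal) - phiStar Z G A P := EReal.sub_le_sub le_rfl
        (h.phiStar_le_of_forall_integral_le hZ0 hfin X' hP.2 (hglb X hX P hP) hle)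

theorem hasDualFormula_CZ [T2Space Ω] [BorelSpace Ω] (h : IsAcceptanceSet (A - G))
    (hZ : ∀ ω, 1 ≤ Z ω) (hZc : Continuous Z)
    (hcomp : ∀ z : ℝ, 0 ≤ z → IsCompact {ω | Z ω ≤ z}) (hcall : CallCondition Z G A)
    (h0 : phi G A 0 = 0) : HasDualFormula Z G A (CZ Z) :=
  h.hasDualFormula hZ hZc hcomp hcall h0 (fun _ hX => hX.1)
    (fun _ hX _ hP => (isLeast_image_continuousMajorants hX fun _ =>
      integral_le_of_mem_continuousMajorants (fun ω => one_pos.trans_le (hZ ω)) hX.1 hP.2).isGLB)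
    (fun _ hX => (isLeast_image_continuousMajorants hX fun _ hY =>
      h.phi_mono hX.1.1 hY.2).isGLB.sInf_eq.symm)

theorem hasDualFormula_UZ [MetrizableSpace Ω] [BorelSpace Ω] (h : IsAcceptanceSet (A - G))
    (hZ : ∀ ω, 1 ≤ Z ω) (hZc : Continuous Z)
    (hcomp : ∀ z : ℝ, 0 ≤ z → IsCompact {ω | Z ω ≤ z}) (hcall : CallCondition Z G A)
    (h0 : phi G A 0 = 0) (husc : UscCondition Z G A) : HasDualFormula Z G A (UZ Z) :=
  h.hasDualFormula hZ hZc hcomp hcall h0 (fun _ hX => hX.1)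
    (fun _ hX _ hP => isGLB_integral_continuousMajorants (fun ω => one_pos.trans_le (hZ ω)) hZc hX
      hP.2) husc

end IsAcceptanceSet

end Duality

section PricingMeasures

variable {Ω : Type*} [TopologicalSpace Ω] [MeasurableSpace Ω] {Z : Ω → ℝ} {G A : Set (Ω → ℝ)}

theorem hasPricingMeasure_of_hasDualFormula {D : Set (Ω → ℝ)} (hD : 0 ∈ D)
    (hdual : HasDualFormula Z G A D) : HasPricingMeasure Z G A D := by
  obtain ⟨-, h0, hmax⟩ := hdual
  obtain ⟨P, hP, hPeq⟩ := (hmax 0 hD).1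
  have hstar : phiStar Z G A P = 0 := by simpa [h0] using hPeq
  refine ⟨P, hP, fun X hX => ?_⟩
  have hle := (hmax X hX.1).2 ⟨P, hP, rfl⟩
  simp only [hstar, sub_zero] at hle
  exact EReal.coe_nonpos.1 (hle.trans (phi_le_zero_of_mem hX.2))

theorem IsAcceptanceSet.noUniformArbitrage_of_hasPricingMeasure [OpensMeasurableSpace Ω]
    (h : IsAcceptanceSet (A - G)) (hZ : ∀ ω, 1 ≤ Z ω)
    (hprice : HasPricingMeasure Z G A (CZ Z)) : NoUniformArbitrage G A := by
  obtain ⟨P, ⟨_, -⟩, hPle⟩ := hprice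
  rintro ⟨X, hX, ε, hε, hXε⟩
  have hint := hPle _ ⟨(const hZ ε).2, h.mem_sub_of_le hX measurable_const hXε⟩
  simp only [const, integral_const, probReal_univ, one_smul] at hint
  exact hint.not_gt hε

theorem exists_isClosed_measure_pos_of_forall_pos [PseudoMetrizableSpace Ω] [BorelSpace Ω]
    {P : Measure Ω} [IsFiniteMeasure P] [NeZero P] {X : Ω → ℝ} (hX : Measurable X)
    (hpos : ∀ ω, 0 < X ω) : ∃ ε > 0, ∃ F, IsClosed F ∧ 0 < P F ∧ ∀ ω ∈ F, ε ≤ X ω := by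
  have hcover : (⋃ n : ℕ, {ω | 1 / ((n : ℝ) + 1) ≤ X ω}) = univ :=
    eq_univ_of_forall fun ω => mem_iUnion.2 ((exists_nat_one_div_lt (hpos ω)).imp fun _ => le_of_lt)
  obtain ⟨n, hn⟩ := exists_measure_pos_of_not_measure_iUnion_null
    (hcover ▸ Measure.measure_univ_ne_zero.2 (NeZero.ne P))
  obtain ⟨F, hFsub, hF, hPF⟩ :=
    (measurableSet_le measurable_const hX).exists_lt_isClosed_of_ne_top (measure_ne_top P _) hn
  exact ⟨1 / (n + 1), by positivity, F, hF, hPF, hFsub⟩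

theorem indicator_const_mem_UZ [OpensMeasurableSpace Ω] (hZ : ∀ ω, 1 ≤ Z ω) {F : Set Ω}
    (hF : IsClosed F) {a : ℝ} (ha : 0 ≤ a) : F.indicator (fun _ => a) ∈ UZ Z := by
  refine ⟨mem_BZ_of_abs_le (fun ω => one_pos.trans_le (hZ ω))
    (measurable_const.indicator hF.measurableSet) (c := a) fun ω => ?_,
    hF.upperSemicontinuous_indicator ha⟩
  rw [abs_of_nonneg (indicator_nonneg (fun _ _ => ha) ω)]
  exact (indicator_le_self' (fun _ _ => ha) ω).trans (le_mul_of_one_le_right ha (hZ ω))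

theorem IsAcceptanceSet.noPointwiseArbitrage_of_hasPricingMeasure [PseudoMetrizableSpace Ω]
    [BorelSpace Ω] (h : IsAcceptanceSet (A - G)) (hZ : ∀ ω, 1 ≤ Z ω)
    (hprice : HasPricingMeasure Z G A (UZ Z)) : NoPointwiseArbitrage G A := by
  obtain ⟨P, ⟨_, -⟩, hPle⟩ := hprice
  rintro ⟨X, hX, hXpos⟩
  have hXm : Measurable X := by simpa using (h.measurable (mem_sub_iff_neg_mem_sub.1 hX)).neg
  obtain ⟨ε, hε, F, hF, hPF, hFX⟩ := exists_isClosed_measure_pos_of_forall_pos (P := P) hXm hXpos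
  have hle : ∀ ω, F.indicator (fun _ => ε) ω ≤ X ω :=
    indicator_le' hFX fun ω _ => (hXpos ω).le
  have hint := hPle _ ⟨indicator_const_mem_UZ hZ hF hε.le,
    h.mem_sub_of_le hX (measurable_const.indicator hF.measurableSet) hle⟩
  rw [integral_indicator_const _ hF.measurableSet, smul_eq_mul] at hint
  exact hint.not_gt (mul_pos (ENNReal.toReal_pos hPF.ne' (measure_ne_top P F)) hε)

end PricingMeasures

theorem NoPointwiseArbitrage.noUniformArbitrage {Ω : Type*} {G A : Set (Ω → ℝ)}
    (hna : NoPointwiseArbitrage G A) : NoUniformArbitrage G A := fun ⟨X, hX, _, hε, hXε⟩ =>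
  hna ⟨X, hX, fun ω => hε.trans_le (hXε ω)⟩

theorem theorem2p1_general {Ω : Type*} [TopologicalSpace Ω] [MetrizableSpace Ω]
    [MeasurableSpace Ω] [BorelSpace Ω] {Z : Ω → ℝ} (hZcont : Continuous Z)
    (hZone : ∀ ω, 1 ≤ Z ω) (hZcompact : ∀ z : ℝ, 0 ≤ z → IsCompact {ω : Ω | Z ω ≤ z})
    {G A : Set (Ω → ℝ)} (hGB : G ⊆ B Ω) (hG0 : (0 : Ω → ℝ) ∈ G) (hAB : A ⊆ B Ω)
    (hBA : BPlus Ω ⊆ A) (hAadd : A + BPlus Ω ⊆ A) (hconv : Convex ℝ (A - G))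
    (hcall : CallCondition Z G A) :
    List.TFAE [
      NoUniformArbitrage G A,
      HasPricingMeasure Z G A (CZ Z),
      HasDualFormula Z G A (CZ Z)] ∧
    (UscCondition Z G A →
      List.TFAE [
        NoUniformArbitrage G A,
        HasPricingMeasure Z G A (CZ Z),
        HasDualFormula Z G A (CZ Z),
        NoPointwiseArbitrage G A,
        HasPricingMeasure Z G A (UZ Z),
        HasDualFormula Z G A (UZ Z)]) := by
  have h : IsAcceptanceSet (A - G) := isAcceptanceSet_sub hGB hG0 hAB hBA hAadd hconv
  have h0 : (0 : Ω → ℝ) ∈ CZ Z := (weightedContinuous Z).zero_mem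
  have h13 (hna : NoUniformArbitrage G A) : HasDualFormula Z G A (CZ Z) :=
    h.hasDualFormula_CZ hZone hZcont hZcompact hcall (h.noUniformArbitrage_iff.1 hna)
  have h32 : HasDualFormula Z G A (CZ Z) → HasPricingMeasure Z G A (CZ Z) :=
    hasPricingMeasure_of_hasDualFormula h0
  have h21 : HasPricingMeasure Z G A (CZ Z) → NoUniformArbitrage G A :=
    h.noUniformArbitrage_of_hasPricingMeasure hZone
  refine ⟨?_, fun husc => ?_⟩
  · tfae_have 1 → 3 := h13
    tfae_have 3 → 2 := h32
    tfae_have 2 → 1 := h21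
    tfae_finish
  · tfae_have 1 → 3 := h13
    tfae_have 3 → 2 := h32
    tfae_have 2 → 1 := h21
    tfae_have 1 → 6 := fun hna => h.hasDualFormula_UZ hZone hZcont hZcompact hcall
      (h.noUniformArbitrage_iff.1 hna) husc
    tfae_have 6 → 5 := hasPricingMeasure_of_hasDualFormula (CZ_subset_UZ h0)
    tfae_have 5 → 4 := h.noPointwiseArbitrage_of_hasPricingMeasure hZone
    tfae_have 4 → 1 := NoPointwiseArbitrage.noUniformArbitrage
    tfae_finish

end RobustHedging

theorem theorem2p1 (T J : ℕ)
    (Ω : Set (RobustHedging.PathSpace T J)) (hΩne : Ω.Nonempty)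
    (hΩ : Ω ⊆ RobustHedging.positivePaths T J)
    (Z : Ω → ℝ) (hZcont : Continuous Z) (hZone : ∀ ω, 1 ≤ Z ω)
    (hZcompact : ∀ z : ℝ, 0 ≤ z → IsCompact {ω : Ω | Z ω ≤ z})
    (G A : Set (Ω → ℝ))
    (hGB : G ⊆ RobustHedging.B Ω) (hG0 : (0 : Ω → ℝ) ∈ G)
    (hAB : A ⊆ RobustHedging.B Ω) (hBA : RobustHedging.BPlus Ω ⊆ A)
    (hAadd : A + RobustHedging.BPlus Ω ⊆ A)
    (hconv : Convex ℝ (A - G))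
    (hcall : RobustHedging.CallCondition Z G A) :
    List.TFAE [
      RobustHedging.NoUniformArbitrage G A,
      RobustHedging.HasPricingMeasure Z G A (RobustHedging.CZ Z),
      RobustHedging.HasDualFormula Z G A (RobustHedging.CZ Z)] ∧
    (RobustHedging.UscCondition Z G A →
      List.TFAE [
        RobustHedging.NoUniformArbitrage G A,
        RobustHedging.HasPricingMeasure Z G A (RobustHedging.CZ Z),
        RobustHedging.HasDualFormula Z G A (RobustHedging.CZ Z),
        RobustHedging.NoPointwiseArbitrage G A,
        RobustHedging.HasPricingMeasure Z G A (RobustHedging.UZ Z),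
        RobustHedging.HasDualFormula Z G A (RobustHedging.UZ Z)]) :=
  RobustHedging.theorem2p1_general hZcont hZone hZcompact hGB hG0 hAB hBA hAadd hconv hcall
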